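/- Let $1\le s<d$ and let $f:\mathbb R^d\to[0,\infty)$ be a probability density with $f\in C^2(\mathbb R^d)$. For a symmetric matrix $A\in\mathbb R^{d\times d}$ let $\lambda_1(A)\ge\dots\ge\lambda_d(A)$ be its eigenvalues, $v_1(A),\dots,v_d(A)$ corresponding orthonormal eigenvectors, and $V_\perp(A)=[v_{s+1}(A),\dots,v_d(A)]$. With $\ell=\log f$ on $\{f>0\}$, assume (A1) $\lambda_s(D^2\ell(x))-\lambda_{s+1}(D^2\ell(x))>0$ for all $x\in\{f>0\}$. Let $K:\mathbb R^d\to[0,\infty)$ be a bounded kernel such that (K0) $\int K(z)\,dz=1$; (K1) $K(z_1,\dots,z_d)=K(\xi_1z_{\sigma(1)},\dots,\xi_dz_{\sigma(d)})$ for all $z\in\mathbb R^d$, all signs $\xi\in\{-1,1\}^d$ and all permutations $\sigma$; (K2) $\int K(z)\,zz^\top dz=I_d$; (K3) $\int K(z)z_1^4\,dz=3$ and $\int K(z)z_1^2z_2^2\,dz=1$. Assume moreover that $f$ is bounded or that $\lVert z\rVert^{d+4}K(z)\to0$ as $\lVert z\rVert\to\infty$ (the latter holds, for example, for every log-concave or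 compactly supported $K$). For $h>0$ let $K_h(z)=h^{-d}K(h^{-1}z)$, let $X$ and $Z_h$ be independent random vectors with densities $f$ and $K_h$, and let $\Sigma_h(x)=\operatorname{Var}(X\mid X+Z_h=x)$ be the covariance matrix of the distribution with density $$q(y)=\frac{f(y)K_h(x-y)}{\int f(u)K_h(x-u)\,du}.$$ Then for every $x$ with $f(x)>0$ the function $q$ is, for all sufficiently small $h>0$, a probability density with finite second moments, and, whatever orthonormal eigenvectors are chosen, $$\bigl\lVert V_\perp(\Sigma_h(x))V_\perp(\Sigma_h(x))^\top-V_\perp(D^2\ell(x))V_\perp(D^2\ell(x))^\top\bigr\rVert_F\to0\qquad\text{as }h\downarrow0,$$ where $\lVert\cdot\rVert_F$ is the Frobenius norm. -/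

import Mathlib

open MeasureTheory Filter Topology

/-! Kernels and densities on `ℝ^d = EuclideanSpace ℝ (Fin d)`. -/

/-- `f` is the density of a probability distribution on `ℝ^d`. -/
structure IsProbDensity {d : ℕ} (f : EuclideanSpace ℝ (Fin d) → ℝ) : Prop where
  nonneg : ∀ x, 0 ≤ f x
  integral_eq_one : ∫ x, f x = 1

/-- A bounded kernel `K : ℝ^d → [0, ∞)` with total mass one, symmetric under sign changes and
permutations of the coordinates, with identity second moment matrix, and with the
fourth moments `μ₄ = 3` and `μ₂₂ = 1` of the standard Gaussian density.
(Under the permutation symmetry the fourth moments do not depend on the coordinates chosen.) -/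
structure IsRidgeKernel {d : ℕ} (K : EuclideanSpace ℝ (Fin d) → ℝ) : Prop where
  nonneg : ∀ z, 0 ≤ K z
  bounded : ∃ C : ℝ, ∀ z, K z ≤ C
  integral_eq_one : ∫ z, K z = 1
  symm : ∀ (z : EuclideanSpace ℝ (Fin d)) (ξ : Fin d → ℝ) (σ : Equiv.Perm (Fin d)),
    (∀ i, ξ i = 1 ∨ ξ i = -1) → K z = K (WithLp.toLp 2 fun i => ξ i * z (σ i))
  second_moment : ∀ i j : Fin d, ∫ z, K z * (z i * z j) = if i = j then 1 else 0
  fourth_moment : ∀ i : Fin d, ∫ z, K z * z i ^ 4 = 3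
  mixed_moment : ∀ i j : Fin d, i ≠ j → ∫ z, K z * (z i ^ 2 * z j ^ 2) = 1

/-- The rescaled kernel `K_h(z) = h^{-d} K(h^{-1} z)`. -/
noncomputable def scaledKernel {d : ℕ} (K : EuclideanSpace ℝ (Fin d) → ℝ) (h : ℝ)
    (z : EuclideanSpace ℝ (Fin d)) : ℝ :=
  (h ^ d)⁻¹ * K (h⁻¹ • z)

/-! The conditional distribution of `X` given `X + Z_h = x`, for independent `X` and `Z_h`
with densities `f` and `K_h`. -/

/-- The density of `X + Z_h`. -/
noncomputable def sumDensity {d : ℕ} (f K : EuclideanSpace ℝ (Fin d) → ℝ) (h : ℝ)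
    (x : EuclideanSpace ℝ (Fin d)) : ℝ :=
  ∫ y, f y * scaledKernel K h (x - y)

/-- The conditional density of `X` given `X + Z_h = x`: the joint density of `(X, X + Z_h)`
at `(y, x)`, divided by the density of `X + Z_h` at `x`. -/
noncomputable def condDensity {d : ℕ} (f K : EuclideanSpace ℝ (Fin d) → ℝ) (h : ℝ)
    (x y : EuclideanSpace ℝ (Fin d)) : ℝ :=
  f y * scaledKernel K h (x - y) / sumDensity f K h x

/-- The conditional distribution of `X` given `X + Z_h = x`. -/
noncomputable def condLaw {d : ℕ} (f K : EuclideanSpace ℝ (Fin d) → ℝ) (h : ℝ)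
    (x : EuclideanSpace ℝ (Fin d)) : Measure (EuclideanSpace ℝ (Fin d)) :=
  volume.withDensity fun y => ENNReal.ofReal (condDensity f K h x y)

/-- The conditional covariance matrix `Σ_h(x) = Var(X | X + Z_h = x)`. -/
noncomputable def condCov {d : ℕ} (f K : EuclideanSpace ℝ (Fin d) → ℝ) (h : ℝ)
    (x : EuclideanSpace ℝ (Fin d)) : Matrix (Fin d) (Fin d) ℝ :=
  Matrix.of fun i j =>
    ProbabilityTheory.covariance (fun y => y i) (fun y => y j) (condLaw f K h x)

/-- The Hessian matrix `D²g(x)`. -/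
noncomputable def hessianMatrix {d : ℕ} (g : EuclideanSpace ℝ (Fin d) → ℝ)
    (x : EuclideanSpace ℝ (Fin d)) : Matrix (Fin d) (Fin d) ℝ :=
  Matrix.of fun i j =>
    iteratedFDeriv ℝ 2 g x ![EuclideanSpace.single i 1, EuclideanSpace.single j 1]

/-! Spectral decomposition of symmetric matrices. Indices start at `0`, so that the `j`-th
largest eigenvalue `λ_j` is `sortedEigenvalue A (j - 1)`. -/

/-- The eigenvalues of a symmetric matrix with multiplicity, in decreasing order
(`0` if the matrix is not symmetric). -/
noncomputable def sortedEigenvalue {d : ℕ} (A : Matrix (Fin d) (Fin d) ℝ) (k : Fin d) : ℝ :=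
  open Classical in
  if hA : A.IsHermitian then hA.eigenvalues₀ (Fin.cast (Fintype.card_fin d).symm k) else 0

/-- The columns of `V` are orthonormal eigenvectors of `A` for the eigenvalues in
decreasing order. -/
def IsEigenvectorMatrix {d : ℕ} (A V : Matrix (Fin d) (Fin d) ℝ) : Prop :=
  V.transpose * V = 1 ∧ A * V = V * Matrix.diagonal (sortedEigenvalue A)

/-- `V_⊥ = [v_{s+1}, …, v_d]`, the last `d - s` columns of `V`. -/
def perpColumns {d : ℕ} (s : ℕ) (V : Matrix (Fin d) (Fin d) ℝ) :
    Matrix (Fin d) {j : Fin d // s ≤ (j : ℕ)} ℝ :=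
  V.submatrix id Subtype.val

/-- The Frobenius norm. -/
noncomputable def frobNorm {d : ℕ} (M : Matrix (Fin d) (Fin d) ℝ) : ℝ :=
  Real.sqrt (∑ i, ∑ j, M i j ^ 2)

/-- The distance of the column spaces of two matrices with orthonormal columns: the
Frobenius distance of the orthogonal projections onto them. -/
noncomputable def projDist {d : ℕ} {ι : Type*} [Fintype ι] (A B : Matrix (Fin d) ι ℝ) : ℝ :=
  frobNorm (A * A.transpose - B * B.transpose)

/-- Every symmetric matrix has an eigenvector matrix. -/
theorem exists_isEigenvectorMatrix {d : ℕ} (A : Matrix (Fin d) (Fin d) ℝ)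
    (hA : A.IsHermitian) : ∃ V, IsEigenvectorMatrix A V := by
  classical
  let e : Fin d ≃ Fin d := (finCongr (Fintype.card_fin d).symm).trans
    (Fintype.equivOfCardEq (Fintype.card_fin _))
  let U : Matrix (Fin d) (Fin d) ℝ := hA.eigenvectorUnitary
  have hU : U.transpose * U = 1 := by
    have := (Matrix.mem_unitaryGroup_iff').1 hA.eigenvectorUnitary.2
    simpa [U, Matrix.star_eq_conjTranspose] using this
  refine ⟨U.submatrix id e, ?_, ?_⟩
  · have : (U.submatrix id e).transpose * U.submatrix id e = (U.transpose * U).submatrix e e := by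
      ext i j; simp [Matrix.mul_apply]
    rw [this, hU, Matrix.submatrix_one_equiv]
  · ext i k
    have h1 := congrFun (hA.mulVec_eigenvectorBasis (e k)) i
    have h2 : sortedEigenvalue A k = hA.eigenvalues (e k) := by
      rw [sortedEigenvalue, dif_pos hA]
      simp [Matrix.IsHermitian.eigenvalues, e]
    rw [Matrix.mul_diagonal, h2, mul_comm]
    simpa [Matrix.mul_apply, Matrix.mulVec, dotProduct, U,
      Matrix.IsHermitian.eigenvectorUnitary_apply] using h1

/-- The conditional covariance matrix is symmetric. -/
theorem condCov_isHermitian {d : ℕ} (f K : EuclideanSpace ℝ (Fin d) → ℝ) (h : ℝ)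
    (x : EuclideanSpace ℝ (Fin d)) : (condCov f K h x).IsHermitian := by
  ext i j
  simp [condCov, ProbabilityTheory.covariance_comm]

/-!
Substituting `y = x - h z`, the conditional covariance is `h ^ 2` times the covariance matrix of the
density proportional to `f (x - h z) K z`. Its moments are expanded by inserting the second order
Taylor polynomial of `f` at `x` (`tendsto_moment_expansion`): the odd moments of `K` vanish by
symmetry and the fourth moments are Gaussian (`IsRidgeKernel.integral_mul_four`), so that, with
`M`, `Mᵢ`, `Mᵢⱼ` the moments of order zero, one and two, and with `H = D²f(x)`,

* `M = f + h² / 2 * tr H + o(h²)`,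
* `Mᵢ = - h ∂ᵢf + o(h)`,
* `Mᵢⱼ = f δᵢⱼ + h² (tr H / 2 * δᵢⱼ + Hᵢⱼ) + o(h²)`.

In `Mᵢⱼ / M - Mᵢ Mⱼ / M²` the traces cancel, and
`h⁻² (h⁻² Σ_h(x) - 1) → H / f - ∇f ∇fᵀ / f² = D² log f(x)` (`tendsto_rescaledCov`).
The remainder in the Taylor expansion is controlled by dominated convergence where `f` is bounded
(`tendsto_integral_remainder_of_bounded`), and by the tail condition on `K` away from `x`
otherwise (`tendsto_integral_far`).

The matrix `h⁻² (h⁻² Σ_h(x) - 1)` has the eigenvectors of `Σ_h(x)`, in the same order. The projections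
converge by a Davis–Kahan inequality (`gap_mul_projDist_le`), which needs the spectral gap of the
limit only. It comes from the variational principle in the quadratic form
`gap / 2 * ‖P' - P‖² ≤ tr (A (P' - P))` for projections `P'` of the same rank as the spectral
projection `P` of `A` (`gap_mul_projDist_sq_le`), applied to both matrices.
-/

/-! ### Second order Taylor expansion and the Hessian of the logarithm -/

section Calculus

/-- The second order Taylor polynomial of `f` at `x` as a function of the increment. -/
noncomputable def taylorTwo {E : Type*} [NormedAddCommGroup E] [NormedSpace ℝ E] (f : E → ℝ)
    (x u : E) : ℝ :=
  f x + fderiv ℝ f x u + 1 / 2 * fderiv ℝ (fderiv ℝ f) x u u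

theorem isLittleO_sub_taylorTwo {E : Type*} [NormedAddCommGroup E] [NormedSpace ℝ E] {f : E → ℝ}
    (hf : ContDiff ℝ 2 f) (x : E) :
    (fun u => f (x + u) - taylorTwo f x u) =o[𝓝 0] fun u => ‖u‖ ^ 2 := by
  have hf1 : ContDiff ℝ 1 (fderiv ℝ f) := hf.fderiv_right (by norm_num)
  have hsymm : IsSymmSndFDerivAt ℝ f x := hf.contDiffAt.isSymmSndFDerivAt (by simp)
  set H := fderiv ℝ (fderiv ℝ f) x with hH
  have hder : ∀ u, HasFDerivAt (fun u => f (x + u) - taylorTwo f x u)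
      (fderiv ℝ f (x + u) - fderiv ℝ f x - H u) u := by
    intro u
    have h1 : HasFDerivAt (fun u => f (x + u)) (fderiv ℝ f (x + u)) u :=
      ((hf.differentiable (by norm_num) (x + u)).hasFDerivAt.comp u
        ((hasFDerivAt_id u).const_add x)).congr_fderiv (by ext; simp)
    have h2 : HasFDerivAt (fun u => H u u) (H u + H.flip u) u :=
      (H.hasFDerivAt_of_bilinear (hasFDerivAt_id u) (hasFDerivAt_id u)).congr_fderiv
        (by ext; simp)
    have h3 : H.flip u = H u := by
      ext v; exact hsymm v u
    rw [h3] at h2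
    refine (h1.sub ((((fderiv ℝ f x).hasFDerivAt (x := u)).const_add (f x)).add
      (h2.const_mul (1 / 2)))).congr_fderiv ?_
    ext v
    simp
    ring
  rw [Asymptotics.isLittleO_iff]
  intro ε hε
  have hd : HasFDerivAt (fderiv ℝ f) H x :=
    (hf1.differentiable (by norm_num) x).hasFDerivAt
  have h5 := (hasFDerivAt_iff_isLittleO_nhds_zero.1 hd).def hε
  obtain ⟨δ, hδ, hball⟩ := Metric.eventually_nhds_iff_ball.1 h5
  filter_upwards [Metric.ball_mem_nhds (0 : E) hδ] with u hu
  have hu' : ‖u‖ < δ := by simpa using hu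
  have := (convex_closedBall (0 : E) ‖u‖).norm_image_sub_le_of_norm_hasFDerivWithin_le
    (f := fun u => f (x + u) - taylorTwo f x u) (C := ε * ‖u‖) (x := 0) (y := u)
    (fun v _ => (hder v).hasFDerivWithinAt)
    (fun v hv => by
      have hv' : ‖v‖ ≤ ‖u‖ := by simpa using hv
      refine (hball v (by simpa using hv'.trans_lt hu')).trans ?_
      gcongr)
    (by simp) (by simp)
  simpa [taylorTwo, sq, mul_assoc] using this

theorem hessianMatrix_log {d : ℕ} {f : EuclideanSpace ℝ (Fin d) → ℝ} (hf : ContDiff ℝ 2 f)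
    {x : EuclideanSpace ℝ (Fin d)} (hx : 0 < f x) (i j : Fin d) :
    hessianMatrix (fun y => Real.log (f y)) x i j
      = fderiv ℝ (fderiv ℝ f) x (EuclideanSpace.single i 1) (EuclideanSpace.single j 1) / f x
        - fderiv ℝ f x (EuclideanSpace.single i 1) * fderiv ℝ f x (EuclideanSpace.single j 1)
          / f x ^ 2 := by
  have hf1 : ContDiff ℝ 1 (fderiv ℝ f) := hf.fderiv_right (by norm_num)
  have hd : ∀ y, HasFDerivAt f (fderiv ℝ f y) y := fun y =>
    (hf.differentiable (by norm_num) y).hasFDerivAt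
  have h1 : fderiv ℝ (fun y => Real.log (f y)) =ᶠ[𝓝 x] fun y => (f y)⁻¹ • fderiv ℝ f y := by
    filter_upwards [hf.continuous.continuousAt.eventually (lt_mem_nhds hx)] with y hy
    exact ((hd y).log (ne_of_gt hy)).fderiv
  have h2 : HasFDerivAt (fun y => (f y)⁻¹ • fderiv ℝ f y)
      ((f x)⁻¹ • fderiv ℝ (fderiv ℝ f) x
        + ((-(f x ^ 2)⁻¹) • fderiv ℝ f x).smulRight (fderiv ℝ f x)) x := by
    have h3 : HasFDerivAt (fun y => (f y)⁻¹) ((-(f x ^ 2)⁻¹) • fderiv ℝ f x) x :=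
      (hasDerivAt_inv (ne_of_gt hx)).comp_hasFDerivAt x (hd x)
    exact h3.smul (hf1.differentiable (by norm_num) x).hasFDerivAt
  simp only [hessianMatrix, Matrix.of_apply, iteratedFDeriv_two_apply]
  rw [h1.fderiv_eq, h2.fderiv]
  simp
  ring

end Calculus

/-! ### Moments of the kernel -/

section Kernel

variable {d : ℕ} {K : EuclideanSpace ℝ (Fin d) → ℝ}

theorem IsProbDensity.integrable {f : EuclideanSpace ℝ (Fin d) → ℝ} (hf : IsProbDensity f) :
    Integrable f :=
  Integrable.of_integral_ne_zero (by rw [hf.integral_eq_one]; exact one_ne_zero)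

theorem IsRidgeKernel.integrable (hK : IsRidgeKernel K) : Integrable K :=
  Integrable.of_integral_ne_zero (by rw [hK.integral_eq_one]; exact one_ne_zero)

theorem IsRidgeKernel.integrable_mul_norm_pow_four (hK : IsRidgeKernel K) :
    Integrable fun z => K z * ‖z‖ ^ 4 := by
  have h4 : ∀ i : Fin d, Integrable fun z : EuclideanSpace ℝ (Fin d) => K z * z i ^ 4 := fun i =>
    Integrable.of_integral_ne_zero (by rw [hK.fourth_moment i]; norm_num)
  have hsum : Integrable fun z : EuclideanSpace ℝ (Fin d) => d * ∑ i, K z * z i ^ 4 :=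
    (integrable_finsetSum _ fun i _ => h4 i).const_mul _
  refine hsum.mono' (hK.integrable.aestronglyMeasurable.mul (by fun_prop))
    (Eventually.of_forall fun z => ?_)
  rw [Real.norm_of_nonneg (mul_nonneg (hK.nonneg z) (by positivity)), ← Finset.mul_sum]
  have h := sq_sum_le_card_mul_sum_sq (s := Finset.univ) (f := fun i : Fin d => z i ^ 2)
  have hn : ‖z‖ ^ 4 = (∑ i, z i ^ 2) ^ 2 := by
    rw [← EuclideanSpace.real_norm_sq_eq]; ring
  rw [hn, mul_left_comm]
  refine mul_le_mul_of_nonneg_left (h.trans (le_of_eq ?_)) (hK.nonneg z)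
  simp [← pow_mul]

theorem IsRidgeKernel.integrable_mul (hK : IsRidgeKernel K) {φ : EuclideanSpace ℝ (Fin d) → ℝ}
    (hφ : Continuous φ) {C : ℝ} (hC : ∀ z, |φ z| ≤ C * (1 + ‖z‖ ^ 4)) :
    Integrable fun z => K z * φ z := by
  refine ((hK.integrable.add hK.integrable_mul_norm_pow_four).const_mul C).mono'
    (hK.integrable.aestronglyMeasurable.mul hφ.aestronglyMeasurable)
    (Eventually.of_forall fun z => ?_)
  rw [norm_mul, Real.norm_of_nonneg (hK.nonneg z), Real.norm_eq_abs]
  refine (mul_le_mul_of_nonneg_left (hC z) (hK.nonneg z)).trans (le_of_eq ?_)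
  simp only [Pi.add_apply]
  ring

theorem abs_coord_le (z : EuclideanSpace ℝ (Fin d)) (i : Fin d) : |z i| ≤ ‖z‖ :=
  PiLp.norm_apply_le z i

theorem IsRidgeKernel.integral_mul_comp_sign (hK : IsRidgeKernel K) (ξ : Fin d → ℝ)
    (hξ : ∀ i, ξ i = 1 ∨ ξ i = -1) (φ : EuclideanSpace ℝ (Fin d) → ℝ) :
    ∫ z, K z * φ (WithLp.toLp 2 fun i => ξ i * z i) = ∫ z, K z * φ z := by
  let e : EuclideanSpace ℝ (Fin d) ≃ₗᵢ[ℝ] EuclideanSpace ℝ (Fin d) :=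
    LinearIsometryEquiv.piLpCongrRight 2 fun i =>
      if ξ i = 1 then LinearIsometryEquiv.refl ℝ ℝ else LinearIsometryEquiv.neg ℝ
  have he : ∀ z, e z = WithLp.toLp 2 fun i => ξ i * z i := fun z => by
    ext i
    rcases hξ i with h | h
    · simp [e, h]
    · have : (-1 : ℝ) ≠ 1 := by norm_num
      simp [e, h, this]
  have h := e.measurePreserving.integral_comp e.toMeasurableEquiv.measurableEmbedding
    (fun z => K z * φ z)
  rw [← h]
  refine integral_congr_ae (Eventually.of_forall fun z => ?_)
  have := hK.symm z ξ 1 hξ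
  simp only [Equiv.Perm.one_apply] at this
  simp only [he, ← this]

theorem IsRidgeKernel.integral_mul_eq_zero_of_sign (hK : IsRidgeKernel K) (ξ : Fin d → ℝ)
    (hξ : ∀ i, ξ i = 1 ∨ ξ i = -1) {φ : EuclideanSpace ℝ (Fin d) → ℝ}
    (hφ : ∀ z, φ (WithLp.toLp 2 fun i => ξ i * z i) = -φ z) : ∫ z, K z * φ z = 0 := by
  have h := hK.integral_mul_comp_sign ξ hξ φ
  simp only [hφ, mul_neg, integral_neg] at h
  linarith

theorem IsRidgeKernel.integral_mul_eq_zero_of_odd (hK : IsRidgeKernel K)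
    {φ : EuclideanSpace ℝ (Fin d) → ℝ} (hφ : ∀ z, φ (-z) = -φ z) : ∫ z, K z * φ z = 0 := by
  refine hK.integral_mul_eq_zero_of_sign (fun _ => -1) (fun _ => Or.inr rfl) fun z => ?_
  rw [← hφ]
  congr 1
  ext i
  simp

/-- The fourth moments agree with those of the standard Gaussian density (Isserlis' formula):
those in which some coordinate occurs an odd number of times vanish by a reflection. -/
theorem IsRidgeKernel.integral_mul_four (hK : IsRidgeKernel K) (i j k l : Fin d) :
    ∫ z, K z * (z i * z j * (z k * z l))
      = (if i = j then 1 else 0) * (if k = l then 1 else 0)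
        + (if i = k then 1 else 0) * (if j = l then 1 else 0)
        + (if i = l then 1 else 0) * (if j = k then 1 else 0) := by
  have hflip : ∀ a : Fin d,
      (if i = a then (-1 : ℝ) else 1) * (if j = a then -1 else 1)
        * ((if k = a then -1 else 1) * (if l = a then -1 else 1)) = -1 →
      ∫ z, K z * (z i * z j * (z k * z l)) = 0 := fun a ha => by
    refine hK.integral_mul_eq_zero_of_sign (fun b => if b = a then -1 else 1)
      (fun b => by by_cases h : b = a <;> simp [h]) fun z => ?_
    refine Eq.trans ?_ ((congrArg (· * (z i * z j * (z k * z l))) ha).trans (neg_one_mul _))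
    simp only
    ring
  have hmixed : ∀ a b : Fin d, a ≠ b → (∀ z : EuclideanSpace ℝ (Fin d),
      z i * z j * (z k * z l) = z a ^ 2 * z b ^ 2) →
      ∫ z, K z * (z i * z j * (z k * z l)) = 1 := fun a b hab h => by
    simp only [h]
    exact hK.mixed_moment a b hab
  by_cases hij : i = j
  · subst hij
    by_cases hkl : k = l
    · subst hkl
      by_cases hik : i = k
      · subst hik
        have h : ∀ z : EuclideanSpace ℝ (Fin d), z i * z i * (z i * z i) = z i ^ 4 :=
          fun z => by ring
        simp only [h, hK.fourth_moment]
        norm_num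
      · rw [hmixed i k hik fun z => by ring]
        simp [hik]
    · rw [hflip k (by by_cases hik : i = k <;> simp [hik, Ne.symm hkl])]
      by_cases hik : i = k
      · simp [hik, hkl]
      · simp [hik, hkl]
  · by_cases hik : i = k
    · subst hik
      by_cases hjl : j = l
      · subst hjl
        rw [hmixed i j hij fun z => by ring]
        simp [hij]
      · rw [hflip j (by simp [hij, Ne.symm hjl])]
        simp [hij, hjl, Ne.symm hij]
    · by_cases hil : i = l
      · subst hil
        by_cases hjk : j = k
        · subst hjk
          rw [hmixed i j hij fun z => by ring]
          simp [hij]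
        · rw [hflip j (by simp [hij, Ne.symm hjk])]
          simp [hij, hik, hjk]
      · rw [hflip i (by simp [Ne.symm hij, Ne.symm hik, Ne.symm hil])]
        simp [hij, hik, hil]

theorem clm_apply_eq_sum {F : Type*} [NormedAddCommGroup F] [NormedSpace ℝ F]
    (L : EuclideanSpace ℝ (Fin d) →L[ℝ] F) (z : EuclideanSpace ℝ (Fin d)) :
    L z = ∑ k, z k • L (EuclideanSpace.single k 1) := by
  conv_lhs => rw [← (EuclideanSpace.basisFun (Fin d) ℝ).sum_repr z]
  simp

theorem bilin_apply_eq_sum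
    (H : EuclideanSpace ℝ (Fin d) →L[ℝ] EuclideanSpace ℝ (Fin d) →L[ℝ] ℝ)
    (z : EuclideanSpace ℝ (Fin d)) :
    H z z = ∑ k, ∑ l, H (EuclideanSpace.single k 1) (EuclideanSpace.single l 1) * (z k * z l) := by
  rw [clm_apply_eq_sum H z, _root_.sum_apply]
  refine Finset.sum_congr rfl fun k _ => ?_
  rw [_root_.smul_apply, clm_apply_eq_sum (H _) z, smul_eq_mul, Finset.mul_sum]
  refine Finset.sum_congr rfl fun l _ => ?_
  rw [smul_eq_mul]
  ring

theorem abs_coord_mul_le (z : EuclideanSpace ℝ (Fin d)) (i j : Fin d) :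
    |z i * z j| ≤ 1 * (1 + ‖z‖ ^ 2) := by
  rw [abs_mul]
  nlinarith [abs_coord_le z i, abs_coord_le z j, abs_nonneg (z i), abs_nonneg (z j), norm_nonneg z]

theorem abs_coord_le_one_add_sq (z : EuclideanSpace ℝ (Fin d)) (i : Fin d) :
    |z i| ≤ 1 * (1 + ‖z‖ ^ 2) := by
  nlinarith [abs_coord_le z i, sq_nonneg (‖z‖ - 1)]

theorem IsRidgeKernel.integral_mul_linear_coord (hK : IsRidgeKernel K)
    (L : EuclideanSpace ℝ (Fin d) →L[ℝ] ℝ) (i : Fin d) :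
    ∫ z, K z * (L z * z i) = L (EuclideanSpace.single i 1) := by
  have h : ∀ z, K z * (L z * z i)
      = ∑ k, L (EuclideanSpace.single k 1) * (K z * (z k * z i)) := fun z => by
    rw [clm_apply_eq_sum L z, Finset.sum_mul, Finset.mul_sum]
    refine Finset.sum_congr rfl fun k _ => ?_
    rw [smul_eq_mul]
    ring
  simp only [h]
  rw [integral_finsetSum]
  · simp [integral_const_mul, hK.second_moment]
  · refine fun k _ => (hK.integrable_mul (by fun_prop) (C := 2) fun z => ?_).const_mul _
    nlinarith [abs_coord_mul_le z k i, sq_nonneg (‖z‖ ^ 2 - 1)]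

theorem IsRidgeKernel.integral_mul_quadratic (hK : IsRidgeKernel K)
    (H : EuclideanSpace ℝ (Fin d) →L[ℝ] EuclideanSpace ℝ (Fin d) →L[ℝ] ℝ) :
    ∫ z, K z * H z z
      = ∑ k, H (EuclideanSpace.single k 1) (EuclideanSpace.single k 1) := by
  have h : ∀ z, K z * H z z
      = ∑ k, K z * (H (EuclideanSpace.single k 1) z * z k) := fun z => by
    conv_lhs => rw [clm_apply_eq_sum H z]
    rw [_root_.sum_apply, Finset.mul_sum]
    refine Finset.sum_congr rfl fun k _ => ?_
    rw [_root_.smul_apply, smul_eq_mul]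
    ring
  simp only [h]
  rw [integral_finsetSum]
  · simp only [hK.integral_mul_linear_coord]
  · refine fun k _ => hK.integrable_mul (by fun_prop)
      (C := 2 * ‖H (EuclideanSpace.single k 1)‖) fun z => ?_
    have h1 := (H (EuclideanSpace.single k 1)).le_opNorm z
    rw [Real.norm_eq_abs] at h1
    rw [abs_mul]
    calc |H (EuclideanSpace.single k 1) z| * |z k|
        ≤ ‖H (EuclideanSpace.single k 1)‖ * ‖z‖ * ‖z‖ :=
          mul_le_mul h1 (abs_coord_le z k) (abs_nonneg _) (by positivity)
      _ = ‖H (EuclideanSpace.single k 1)‖ * (‖z‖ ^ 2) := by ring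
      _ ≤ ‖H (EuclideanSpace.single k 1)‖ * (2 * (1 + ‖z‖ ^ 4)) := by
          gcongr
          nlinarith [sq_nonneg (‖z‖ ^ 2 - 1)]
      _ = _ := by ring

theorem IsRidgeKernel.integral_mul_quadratic_coord_coord (hK : IsRidgeKernel K)
    (H : EuclideanSpace ℝ (Fin d) →L[ℝ] EuclideanSpace ℝ (Fin d) →L[ℝ] ℝ) (i j : Fin d) :
    ∫ z, K z * (H z z * (z i * z j))
      = (if i = j then 1 else 0)
          * ∑ k, H (EuclideanSpace.single k 1) (EuclideanSpace.single k 1)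
        + H (EuclideanSpace.single i 1) (EuclideanSpace.single j 1)
        + H (EuclideanSpace.single j 1) (EuclideanSpace.single i 1) := by
  have h : ∀ z, K z * (H z z * (z i * z j)) = ∑ k, ∑ l,
      H (EuclideanSpace.single k 1) (EuclideanSpace.single l 1)
        * (K z * (z k * z l * (z i * z j))) := fun z => by
    rw [bilin_apply_eq_sum H z]
    simp only [Finset.sum_mul, Finset.mul_sum]
    refine Finset.sum_congr rfl fun k _ => Finset.sum_congr rfl fun l _ => ?_
    ring
  have hint : ∀ k l : Fin d, Integrable fun z : EuclideanSpace ℝ (Fin d) =>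
      H (EuclideanSpace.single k 1) (EuclideanSpace.single l 1)
        * (K z * (z k * z l * (z i * z j))) := fun k l => by
    refine (hK.integrable_mul (by fun_prop) (C := 2) fun z => ?_).const_mul _
    rw [abs_mul]
    calc |z k * z l| * |z i * z j| ≤ 1 * (1 + ‖z‖ ^ 2) * (1 * (1 + ‖z‖ ^ 2)) :=
          mul_le_mul (abs_coord_mul_le z k l) (abs_coord_mul_le z i j) (abs_nonneg _)
            (by positivity)
      _ ≤ 2 * (1 + ‖z‖ ^ 4) := by nlinarith [sq_nonneg (‖z‖ ^ 2 - 1)]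
  simp only [h]
  rw [integral_finsetSum _ fun k _ => integrable_finsetSum _ fun l _ => hint k l]
  simp only [integral_finsetSum _ fun l _ => hint _ l, integral_const_mul, hK.integral_mul_four,
    mul_add, Finset.sum_add_distrib]
  simp [Finset.mul_sum, mul_comm]

end Kernel

/-! ### Small bandwidth expansion of the kernel moments -/

section Expansion

variable {d : ℕ} {f g K φ : EuclideanSpace ℝ (Fin d) → ℝ} {C : ℝ} {x : EuclideanSpace ℝ (Fin d)}

theorem integral_comp_sub_smul (F : EuclideanSpace ℝ (Fin d) → ℝ) (x : EuclideanSpace ℝ (Fin d))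
    {h : ℝ} (hh : 0 < h) : ∫ z, F (x - h • z) = (h ^ d)⁻¹ * ∫ y, F y := by
  rw [Measure.integral_comp_smul volume (fun y => F (x - y)) h, integral_sub_left_eq_self F,
    finrank_euclideanSpace_fin, abs_of_pos (by positivity), smul_eq_mul]

theorem integrable_comp_sub_smul_iff (F : EuclideanSpace ℝ (Fin d) → ℝ)
    (x : EuclideanSpace ℝ (Fin d)) {h : ℝ} (hh : 0 < h) :
    Integrable (fun z => F (x - h • z)) ↔ Integrable F := by
  rw [integrable_comp_smul_iff volume (fun y => F (x - y)) hh.ne', integrable_comp_sub_left]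

theorem IsRidgeKernel.integrable_mul_of_sq (hK : IsRidgeKernel K) (hφ : Continuous φ)
    (hC : ∀ z, |φ z| ≤ C * (1 + ‖z‖ ^ 2)) : Integrable fun z => K z * φ z := by
  have hC0 : 0 ≤ C := by simpa using (abs_nonneg _).trans (hC 0)
  refine hK.integrable_mul hφ (C := C * 2) fun z => (hC z).trans ?_
  rw [mul_assoc]
  gcongr
  nlinarith [sq_nonneg (‖z‖ ^ 2 - 1)]

theorem exists_abs_mul_le_of_tail (hK : IsRidgeKernel K)
    (htail : Tendsto (fun z => ‖z‖ ^ (d + 4) * K z) (Bornology.cobounded _) (𝓝 0))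
    (hC : ∀ z, |φ z| ≤ C * (1 + ‖z‖ ^ 2)) : ∃ B, ∀ z, |K z * φ z| ≤ B := by
  have hC0 : 0 ≤ C := by simpa using (abs_nonneg _).trans (hC 0)
  obtain ⟨M, hM⟩ := hK.bounded
  have hM0 : 0 ≤ M := (hK.nonneg 0).trans (hM 0)
  have h1 := htail.eventually (ge_mem_nhds one_pos)
  rw [← comap_norm_atTop, eventually_comap] at h1
  obtain ⟨R, hR⟩ := eventually_atTop.1 h1
  refine ⟨M * (C * (1 + max R 1 ^ 2)) + 2 * C, fun z => ?_⟩
  rw [abs_mul, abs_of_nonneg (hK.nonneg z)]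
  rcases le_total ‖z‖ (max R 1) with hz | hz
  · calc K z * |φ z| ≤ M * (C * (1 + max R 1 ^ 2)) := by
          refine mul_le_mul (hM z) ((hC z).trans ?_) (abs_nonneg _) hM0
          gcongr
      _ ≤ _ := by linarith
  · have h2 : ‖z‖ ^ (d + 4) * K z ≤ 1 := hR ‖z‖ ((le_max_left _ _).trans hz) z rfl
    have h3 : (1 : ℝ) ≤ ‖z‖ := (le_max_right _ _).trans hz
    have h4 : 1 + ‖z‖ ^ 2 ≤ 2 * ‖z‖ ^ (d + 4) := by
      have h5 : ‖z‖ ^ 2 ≤ ‖z‖ ^ (d + 4) := pow_le_pow_right₀ h3 (by omega)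
      have h6 : (1 : ℝ) ≤ ‖z‖ ^ (d + 4) := one_le_pow₀ h3
      linarith
    calc K z * |φ z| ≤ K z * (C * (2 * ‖z‖ ^ (d + 4))) := by
          refine mul_le_mul_of_nonneg_left ((hC z).trans ?_) (hK.nonneg z)
          gcongr
      _ = 2 * C * (‖z‖ ^ (d + 4) * K z) := by ring
      _ ≤ 2 * C * 1 := by gcongr
      _ ≤ _ := by rw [mul_one]; exact le_add_of_nonneg_left (by positivity)

theorem integrable_shifted_mul_kernel (hf : IsProbDensity f) (hfc : Continuous f)
    (hK : IsRidgeKernel K)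
    (htail : (∃ C : ℝ, ∀ x, f x ≤ C) ∨
      Tendsto (fun z => ‖z‖ ^ (d + 4) * K z) (Bornology.cobounded _) (𝓝 0))
    (hφ : Continuous φ) (hC : ∀ z, |φ z| ≤ C * (1 + ‖z‖ ^ 2)) {h : ℝ} (hh : 0 < h) :
    Integrable fun z => f (x - h • z) * (K z * φ z) := by
  have hKφ := hK.integrable_mul_of_sq hφ hC
  rcases htail with ⟨M, hM⟩ | htail
  · refine hKφ.bdd_mul (c := M) (by fun_prop) (Eventually.of_forall fun z => ?_)
    rw [Real.norm_of_nonneg (hf.nonneg _)]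
    exact hM _
  · obtain ⟨B, hB⟩ := exists_abs_mul_le_of_tail hK htail hC
    exact ((integrable_comp_sub_smul_iff f x hh).2 hf.integrable).mul_bdd
      hKφ.aestronglyMeasurable (Eventually.of_forall hB)

theorem continuous_taylorTwo (f : EuclideanSpace ℝ (Fin d) → ℝ) (x : EuclideanSpace ℝ (Fin d)) :
    Continuous (taylorTwo f x) := by
  unfold taylorTwo
  fun_prop

theorem abs_taylorTwo_le (f : EuclideanSpace ℝ (Fin d) → ℝ) (x u : EuclideanSpace ℝ (Fin d)) :
    |taylorTwo f x u| ≤ |f x| + ‖fderiv ℝ f x‖ * ‖u‖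
      + ‖fderiv ℝ (fderiv ℝ f) x‖ * ‖u‖ ^ 2 := by
  have h1 : |fderiv ℝ f x u| ≤ ‖fderiv ℝ f x‖ * ‖u‖ := (fderiv ℝ f x).le_opNorm u
  have h2 : |fderiv ℝ (fderiv ℝ f) x u u| ≤ ‖fderiv ℝ (fderiv ℝ f) x‖ * ‖u‖ * ‖u‖ :=
    (fderiv ℝ (fderiv ℝ f) x).le_opNorm₂ u u
  unfold taylorTwo
  refine (abs_add_le _ _).trans (add_le_add ((abs_add_le _ _).trans ?_) ?_)
  · gcongr
  · rw [abs_mul, abs_of_pos (by norm_num : (0 : ℝ) < 1 / 2)]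
    nlinarith [abs_nonneg (fderiv ℝ (fderiv ℝ f) x u u)]

theorem IsRidgeKernel.integrable_mul_mul (hK : IsRidgeKernel K)
    {ψ : EuclideanSpace ℝ (Fin d) → ℝ} {C' : ℝ} (hψ : Continuous ψ) (hφ : Continuous φ)
    (hC' : ∀ z, |ψ z| ≤ C' * (1 + ‖z‖ ^ 2)) (hC : ∀ z, |φ z| ≤ C * (1 + ‖z‖ ^ 2)) :
    Integrable fun z => K z * (ψ z * φ z) := by
  have hC0 : 0 ≤ C := by simpa using (abs_nonneg _).trans (hC 0)
  have hC0' : 0 ≤ C' := by simpa using (abs_nonneg _).trans (hC' 0)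
  refine hK.integrable_mul (hψ.mul hφ) (C := C' * C * 2) fun z => ?_
  rw [abs_mul]
  calc |ψ z| * |φ z| ≤ C' * (1 + ‖z‖ ^ 2) * (C * (1 + ‖z‖ ^ 2)) :=
        mul_le_mul (hC' z) (hC z) (abs_nonneg _) (by positivity)
    _ = C' * C * ((1 + ‖z‖ ^ 2) ^ 2) := by ring
    _ ≤ C' * C * (2 * (1 + ‖z‖ ^ 4)) := by
        gcongr
        nlinarith [sq_nonneg (‖z‖ ^ 2 - 1)]
    _ = _ := by ring

theorem integrable_taylorTwo_mul_kernel (hK : IsRidgeKernel K) (hφ : Continuous φ)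
    (hC : ∀ z, |φ z| ≤ C * (1 + ‖z‖ ^ 2)) (h : ℝ) :
    Integrable fun z => taylorTwo f x (-(h • z)) * (K z * φ z) := by
  refine (hK.integrable_mul_mul (ψ := fun z => taylorTwo f x (-(h • z)))
    (C' := (|f x| + ‖fderiv ℝ f x‖ + ‖fderiv ℝ (fderiv ℝ f) x‖) * (1 + h ^ 2))
    ((continuous_taylorTwo f x).comp (by fun_prop)) hφ (fun z => ?_) hC).congr
    (Eventually.of_forall fun z => mul_left_comm _ _ _)
  set u := -(h • z) with hu
  have hn : ‖u‖ ^ 2 = h ^ 2 * ‖z‖ ^ 2 := by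
    rw [hu, norm_neg, norm_smul, mul_pow, Real.norm_eq_abs, sq_abs]
  calc |taylorTwo f x u| ≤ _ := abs_taylorTwo_le f x u
    _ ≤ |f x| * (1 + ‖u‖ ^ 2) + ‖fderiv ℝ f x‖ * (1 + ‖u‖ ^ 2)
        + ‖fderiv ℝ (fderiv ℝ f) x‖ * (1 + ‖u‖ ^ 2) := by
        gcongr
        · exact le_mul_of_one_le_right (abs_nonneg _) (by nlinarith)
        · nlinarith [sq_nonneg (‖u‖ - 1)]
        · linarith
    _ = (|f x| + ‖fderiv ℝ f x‖ + ‖fderiv ℝ (fderiv ℝ f) x‖) * (1 + h ^ 2 * ‖z‖ ^ 2) := by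
        rw [← hn]; ring
    _ ≤ (|f x| + ‖fderiv ℝ f x‖ + ‖fderiv ℝ (fderiv ℝ f) x‖)
        * ((1 + h ^ 2) * (1 + ‖z‖ ^ 2)) := by
        gcongr
        nlinarith [sq_nonneg h, sq_nonneg ‖z‖]
    _ = _ := by ring

/-- For a bounded function with a second order Taylor expansion at `x`, the remainder is bounded
by a multiple of `‖u‖ ^ 2` everywhere, and dominated convergence against the fourth moments of the
kernel gives the expansion of the smoothed moments. -/
theorem tendsto_integral_remainder_of_bounded (hK : IsRidgeKernel K)
    (hgm : Measurable g) (hgb : ∃ M, ∀ y, |g y| ≤ M)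
    (hg : (fun u => g (x + u) - taylorTwo f x u) =o[𝓝 0] fun u => ‖u‖ ^ 2)
    (hφ : Continuous φ) (hC : ∀ z, |φ z| ≤ C * (1 + ‖z‖ ^ 2)) :
    Tendsto (fun h : ℝ => (h ^ 2)⁻¹ *
      ∫ z, (g (x - h • z) - taylorTwo f x (-(h • z))) * (K z * φ z)) (𝓝[>] 0) (𝓝 0) := by
  have hC0 : 0 ≤ C := by simpa using (abs_nonneg _).trans (hC 0)
  obtain ⟨M, hM⟩ := hgb
  have hM0 : 0 ≤ M := (abs_nonneg _).trans (hM 0)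
  set r := fun u => g (x + u) - taylorTwo f x u with hr
  have hrm : Measurable r :=
    (hgm.comp (measurable_const_add x)).sub (continuous_taylorTwo f x).measurable
  have hbound : ∃ A, 0 ≤ A ∧ ∀ u, |r u| ≤ A * ‖u‖ ^ 2 := by
    obtain ⟨δ, hδ, hball⟩ := Metric.eventually_nhds_iff_ball.1 (hg.def one_pos)
    set a := M + |f x|
    set b := ‖fderiv ℝ f x‖
    set c := ‖fderiv ℝ (fderiv ℝ f) x‖
    have ha : 0 ≤ a := by positivity
    refine ⟨1 + (a / δ ^ 2 + b / δ + c), by positivity, fun u => ?_⟩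
    rcases lt_or_ge ‖u‖ δ with hu | hu
    · have := hball u (by simpa using hu)
      simp only [Real.norm_eq_abs, abs_pow, abs_norm, one_mul] at this
      refine this.trans (le_mul_of_one_le_left (by positivity) ?_)
      have : 0 ≤ a / δ ^ 2 + b / δ + c := by positivity
      linarith
    · have h1 : |r u| ≤ a + b * ‖u‖ + c * ‖u‖ ^ 2 := by
        have := (abs_sub _ _).trans (add_le_add (hM (x + u)) (abs_taylorTwo_le f x u))
        simp only [hr]
        linarith
      have h2 : a ≤ a / δ ^ 2 * ‖u‖ ^ 2 := by
        rw [div_mul_eq_mul_div, le_div_iff₀ (by positivity)]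
        gcongr
      have h3 : b * ‖u‖ ≤ b / δ * ‖u‖ ^ 2 := by
        rw [div_mul_eq_mul_div, le_div_iff₀ hδ, sq, ← mul_assoc]
        gcongr
      nlinarith [sq_nonneg ‖u‖]
  obtain ⟨A, hA0, hA⟩ := hbound
  have hlim : Tendsto (fun h : ℝ => ∫ z, (h ^ 2)⁻¹ * (r (-(h • z)) * (K z * φ z))) (𝓝[>] 0)
      (𝓝 (∫ _ : EuclideanSpace ℝ (Fin d), (0 : ℝ))) := by
    refine tendsto_integral_filter_of_dominated_convergence
      (fun z => A * C * 2 * (K z * (1 + ‖z‖ ^ 4))) ?_ ?_ ?_ ?_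
    · refine Eventually.of_forall fun h => ?_
      have h1 : AEStronglyMeasurable (fun z => r (-(h • z))) volume :=
        (hrm.comp (by fun_prop : Measurable fun z : EuclideanSpace ℝ (Fin d) =>
          -(h • z))).aestronglyMeasurable
      exact (h1.mul (hK.integrable_mul_of_sq hφ hC).aestronglyMeasurable).const_mul _
    · filter_upwards [self_mem_nhdsWithin] with h hh
      refine Eventually.of_forall fun z => ?_
      have hh0 : (0 : ℝ) < h := hh
      have h1 := hA (-(h • z))
      rw [norm_neg, norm_smul, Real.norm_of_nonneg hh0.le, mul_pow] at h1
      rw [norm_mul, norm_mul, norm_mul, Real.norm_of_nonneg (hK.nonneg z),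
        Real.norm_of_nonneg (by positivity : 0 ≤ (h ^ 2)⁻¹), Real.norm_eq_abs, Real.norm_eq_abs]
      calc (h ^ 2)⁻¹ * (|r (-(h • z))| * (K z * |φ z|))
          ≤ (h ^ 2)⁻¹ * (A * (h ^ 2 * ‖z‖ ^ 2) * (K z * (C * (1 + ‖z‖ ^ 2)))) := by
            have := hK.nonneg z
            gcongr
            exact hC z
        _ = A * C * (K z * (‖z‖ ^ 2 + ‖z‖ ^ 4)) := by
            field_simp
        _ ≤ A * C * (K z * (2 * (1 + ‖z‖ ^ 4))) := by
            have := hK.nonneg z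
            gcongr
            nlinarith [sq_nonneg (‖z‖ ^ 2 - 1)]
        _ = _ := by ring
    · refine Integrable.const_mul (hK.integrable_mul (by fun_prop) (C := 1) fun z => ?_) _
      rw [abs_of_nonneg (by positivity), one_mul]
    · refine Eventually.of_forall fun z => ?_
      have ht : Tendsto (fun h : ℝ => -(h • z)) (𝓝[>] 0) (𝓝 0) := by
        have : Continuous fun h : ℝ => -(h • z) := by fun_prop
        simpa using (this.tendsto 0).mono_left nhdsWithin_le_nhds
      have h1 : Tendsto (fun h : ℝ => r (-(h • z)) / h ^ 2) (𝓝[>] 0) (𝓝 0) := by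
        refine Asymptotics.IsLittleO.tendsto_div_nhds_zero ?_
        refine (hg.comp_tendsto ht).trans_isBigO
          (Asymptotics.IsBigO.of_bound (‖z‖ ^ 2) (Eventually.of_forall fun h => ?_))
        simp [norm_smul, mul_pow, mul_comm]
      have h2 := h1.mul_const (K z * φ z)
      rw [zero_mul] at h2
      refine h2.congr fun h => ?_
      ring
  simp only [integral_zero, integral_const_mul] at hlim
  simpa only [hr, sub_eq_add_neg] using hlim

/-- Under the tail condition on the kernel, the mass of `f` away from `x` does not contribute to
the moments up to second order, whatever the size of `f`. -/
theorem tendsto_integral_far (hf : IsProbDensity f) (hK : IsRidgeKernel K)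
    (htail : Tendsto (fun z => ‖z‖ ^ (d + 4) * K z) (Bornology.cobounded _) (𝓝 0))
    (hC : ∀ z, |φ z| ≤ C * (1 + ‖z‖ ^ 2)) :
    Tendsto (fun h : ℝ => (h ^ 2)⁻¹ *
      ∫ z, (Metric.closedBall x 1)ᶜ.indicator f (x - h • z) * (K z * φ z)) (𝓝[>] 0) (𝓝 0) := by
  have hC0 : 0 ≤ C := by simpa using (abs_nonneg _).trans (hC 0)
  rw [Metric.tendsto_nhds]
  intro ε hε
  set η := ε / (2 * (2 * C + 1)) with hη
  have hη0 : 0 < η := by positivity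
  have h1 := htail.eventually (ge_mem_nhds hη0)
  rw [← comap_norm_atTop, eventually_comap] at h1
  obtain ⟨R, hR⟩ := eventually_atTop.1 h1
  have hR0 : (0 : ℝ) < (max R 1)⁻¹ := by positivity
  filter_upwards [Ioo_mem_nhdsGT hR0] with h hh
  have hh0 : 0 < h := hh.1
  have hpt : ∀ z, ‖(Metric.closedBall x 1)ᶜ.indicator f (x - h • z) * (K z * φ z)‖
      ≤ f (x - h • z) * (2 * C * η * h ^ (d + 2)) := fun z => by
    have hnn := hf.nonneg (x - h • z)
    by_cases hz : x - h • z ∈ (Metric.closedBall x 1)ᶜ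
    · rw [Set.indicator_of_mem hz, norm_mul, Real.norm_of_nonneg hnn]
      refine mul_le_mul_of_nonneg_left ?_ hnn
      have hz1 : 1 < h * ‖z‖ := by
        simpa [norm_smul, abs_of_pos hh0] using hz
      have hzn : max R 1 ≤ ‖z‖ := by
        have h2 : h * max R 1 < 1 := by
          have := mul_lt_mul_of_pos_right hh.2 (by positivity : 0 < max R 1)
          rwa [inv_mul_cancel₀ (by positivity)] at this
        exact (lt_of_mul_lt_mul_left (h2.trans hz1) hh0.le).le
      have hz2 : (1 : ℝ) ≤ ‖z‖ := (le_max_right _ _).trans hzn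
      have hKz : ‖z‖ ^ (d + 4) * K z ≤ η := hR _ ((le_max_left _ _).trans hzn) z rfl
      rw [norm_mul, Real.norm_of_nonneg (hK.nonneg z), Real.norm_eq_abs]
      calc K z * |φ z| ≤ K z * (C * (2 * ‖z‖ ^ 2)) := by
            refine mul_le_mul_of_nonneg_left ((hC z).trans ?_) (hK.nonneg z)
            gcongr
            nlinarith
        -- off the unit ball `1 < h ‖z‖`, which trades `‖z‖ ^ (d + 2)` for `h ^ (d + 2)`
        _ = K z * (C * (2 * ‖z‖ ^ 2)) * 1 := (mul_one _).symm
        _ ≤ K z * (C * (2 * ‖z‖ ^ 2)) * (h * ‖z‖) ^ (d + 2) := by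
            have := hK.nonneg z
            gcongr
            exact one_le_pow₀ hz1.le
        _ = 2 * C * (‖z‖ ^ (d + 4) * K z) * h ^ (d + 2) := by ring
        _ ≤ 2 * C * η * h ^ (d + 2) := by gcongr
    · rw [Set.indicator_of_notMem hz, zero_mul, norm_zero]
      positivity
  have hint := norm_integral_le_of_norm_le
    (((integrable_comp_sub_smul_iff f x hh0).2 hf.integrable).mul_const
      (2 * C * η * h ^ (d + 2))) (Eventually.of_forall hpt)
  rw [integral_mul_const, integral_comp_sub_smul f x hh0, hf.integral_eq_one, mul_one] at hint
  rw [dist_zero_right, norm_mul, Real.norm_of_nonneg (by positivity : 0 ≤ (h ^ 2)⁻¹)]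
  calc _ ≤ (h ^ 2)⁻¹ * ((h ^ d)⁻¹ * (2 * C * η * h ^ (d + 2))) := by gcongr
    _ = 2 * C * η := by field_simp; ring
    _ ≤ (2 * C + 1) * η := by gcongr; linarith
    _ = ε / 2 := by rw [hη]; field_simp
    _ < ε := half_lt_self hε

/-- If `f` is unbounded it is split at the sphere of radius `1` around `x`. The part inside is
bounded and has the same Taylor expansion at `x`. -/
theorem tendsto_integral_remainder (hf : IsProbDensity f) (hf2 : ContDiff ℝ 2 f)
    (hK : IsRidgeKernel K)
    (htail : (∃ C : ℝ, ∀ x, f x ≤ C) ∨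
      Tendsto (fun z => ‖z‖ ^ (d + 4) * K z) (Bornology.cobounded _) (𝓝 0))
    (hφ : Continuous φ) (hC : ∀ z, |φ z| ≤ C * (1 + ‖z‖ ^ 2)) :
    Tendsto (fun h : ℝ => (h ^ 2)⁻¹ *
      ∫ z, (f (x - h • z) - taylorTwo f x (-(h • z))) * (K z * φ z)) (𝓝[>] 0) (𝓝 0) := by
  have hfc := hf2.continuous
  have hT := isLittleO_sub_taylorTwo hf2 x
  rcases htail with ⟨M, hM⟩ | htail
  · exact tendsto_integral_remainder_of_bounded hK hfc.measurable
      ⟨M, fun y => by rw [abs_of_nonneg (hf.nonneg y)]; exact hM y⟩ hT hφ hC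
  set S := Metric.closedBall x 1 with hS
  have hSm : MeasurableSet S := Metric.isClosed_closedBall.measurableSet
  obtain ⟨M, hM⟩ := (isCompact_closedBall x 1).exists_bound_of_continuousOn hfc.continuousOn
  have hM0 : 0 ≤ M := (norm_nonneg _).trans (hM x (by simp))
  have hnearb : ∀ y, |S.indicator f y| ≤ M := fun y => by
    by_cases hy : y ∈ S
    · rw [Set.indicator_of_mem hy]; exact hM y hy
    · rw [Set.indicator_of_notMem hy, abs_zero]; exact hM0
  have hnear := tendsto_integral_remainder_of_bounded (f := f) (x := x) hK
    (hfc.measurable.indicator hSm) ⟨M, hnearb⟩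
    (hT.congr' (by
      filter_upwards [Metric.ball_mem_nhds (0 : EuclideanSpace ℝ (Fin d)) one_pos] with u hu
      rw [Set.indicator_of_mem]
      have : ‖u‖ < 1 := by simpa using hu
      simpa [hS] using this.le) EventuallyEq.rfl) hφ hC
  have hfar := tendsto_integral_far (x := x) hf hK htail hC
  have hsum := hnear.add hfar
  rw [add_zero] at hsum
  refine hsum.congr' ?_
  filter_upwards [self_mem_nhdsWithin] with h hh
  have hKφ := hK.integrable_mul_of_sq hφ hC
  obtain ⟨B, hB⟩ := exists_abs_mul_le_of_tail hK htail hC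
  have hshift : Measurable fun z : EuclideanSpace ℝ (Fin d) => x - h • z := by fun_prop
  have hfint := integrable_shifted_mul_kernel (x := x) hf hfc hK (Or.inr htail) hφ hC hh
  have hi1 : Integrable fun z => S.indicator f (x - h • z) * (K z * φ z) :=
    hKφ.bdd_mul (c := M) ((hfc.measurable.indicator hSm).comp hshift).aestronglyMeasurable
      (Eventually.of_forall fun z => hnearb _)
  have hsplit : ∀ y, f y = S.indicator f y + Sᶜ.indicator f y := fun y =>
    (congrFun (Set.indicator_self_add_compl S f) y).symm
  have hi2 : Integrable fun z => Sᶜ.indicator f (x - h • z) * (K z * φ z) := by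
    refine (hfint.sub hi1).congr (Eventually.of_forall fun z => ?_)
    simp only [Pi.sub_apply]
    rw [hsplit (x - h • z)]
    ring
  have hi3 := integrable_taylorTwo_mul_kernel (f := f) (x := x) hK hφ hC h
  rw [← mul_add]
  congr 1
  simp only [sub_mul]
  rw [integral_sub hi1 hi3, integral_sub hfint hi3, sub_add_eq_add_sub, ← integral_add hi1 hi2]
  congr 1
  refine integral_congr_ae (Eventually.of_forall fun z => ?_)
  simp only
  rw [← add_mul, ← hsplit]

/-- The second order expansion in the bandwidth `h` of the moments of `K`, weighted by
`z ↦ f (x - h z)`. -/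
theorem tendsto_moment_expansion (hf : IsProbDensity f) (hf2 : ContDiff ℝ 2 f)
    (hK : IsRidgeKernel K)
    (htail : (∃ C : ℝ, ∀ x, f x ≤ C) ∨
      Tendsto (fun z => ‖z‖ ^ (d + 4) * K z) (Bornology.cobounded _) (𝓝 0))
    (hφ : Continuous φ) (hC : ∀ z, |φ z| ≤ C * (1 + ‖z‖ ^ 2)) :
    Tendsto (fun h : ℝ => (h ^ 2)⁻¹ * ((∫ z, f (x - h • z) * (K z * φ z))
      - (f x * (∫ z, K z * φ z) - h * (∫ z, K z * (fderiv ℝ f x z * φ z))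
        + h ^ 2 / 2 * ∫ z, K z * (fderiv ℝ (fderiv ℝ f) x z z * φ z)))) (𝓝[>] 0) (𝓝 0) := by
  refine (tendsto_integral_remainder (x := x) hf hf2 hK htail hφ hC).congr' ?_
  filter_upwards [self_mem_nhdsWithin] with h hh
  have hfint := integrable_shifted_mul_kernel (x := x) hf hf2.continuous hK htail hφ hC hh
  have hi3 := integrable_taylorTwo_mul_kernel (f := f) (x := x) hK hφ hC h
  have hL : Integrable fun z => K z * (fderiv ℝ f x z * φ z) :=
    hK.integrable_mul_mul (by fun_prop) hφ (C' := ‖fderiv ℝ f x‖) (fun z => by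
      refine ((fderiv ℝ f x).le_opNorm z).trans ?_
      gcongr
      nlinarith [sq_nonneg (‖z‖ - 1)]) hC
  have hH : Integrable fun z => K z * (fderiv ℝ (fderiv ℝ f) x z z * φ z) :=
    hK.integrable_mul_mul (by fun_prop) hφ (C' := ‖fderiv ℝ (fderiv ℝ f) x‖) (fun z => by
      refine ((fderiv ℝ (fderiv ℝ f) x).le_opNorm₂ z z).trans ?_
      rw [mul_assoc]
      gcongr
      nlinarith) hC
  have hKφ := hK.integrable_mul_of_sq hφ hC
  have h01 : Integrable fun z => f x * (K z * φ z) - h * (K z * (fderiv ℝ f x z * φ z)) :=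
    (hKφ.const_mul _).sub (hL.const_mul _)
  congr 1
  simp only [sub_mul]
  rw [integral_sub hfint hi3]
  congr 1
  rw [← integral_const_mul, ← integral_const_mul, ← integral_const_mul,
    ← integral_sub (hKφ.const_mul _) (hL.const_mul _), ← integral_add h01 (hH.const_mul _)]
  refine integral_congr_ae (Eventually.of_forall fun z => ?_)
  simp [taylorTwo]
  ring

end Expansion

/-! ### The conditional law and its covariance matrix -/

section Conditional

variable {d : ℕ} {f K : EuclideanSpace ℝ (Fin d) → ℝ} {x : EuclideanSpace ℝ (Fin d)}

/-- The moment `∫ f (x - h z) K z φ z dz` of the kernel, weighted by the density `f` around `x` at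
scale `h`. -/
noncomputable def shiftedMoment (f K : EuclideanSpace ℝ (Fin d) → ℝ)
    (x : EuclideanSpace ℝ (Fin d)) (φ : EuclideanSpace ℝ (Fin d) → ℝ) (h : ℝ) : ℝ :=
  ∫ z, f (x - h • z) * (K z * φ z)

/-- The substitution `y = x - h z`. -/
theorem integral_mul_scaledKernel (φ : EuclideanSpace ℝ (Fin d) → ℝ) {h : ℝ} (hh : 0 < h) :
    ∫ y, f y * scaledKernel K h (x - y) * φ y = shiftedMoment f K x (fun z => φ (x - h • z)) h := by
  have h1 := integral_comp_sub_smul (fun y => f y * scaledKernel K h (x - y) * φ y) x hh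
  have h2 : ∀ z, f (x - h • z) * scaledKernel K h (x - (x - h • z)) * φ (x - h • z)
      = (h ^ d)⁻¹ * (f (x - h • z) * (K z * φ (x - h • z))) := fun z => by
    rw [sub_sub_cancel, scaledKernel, smul_smul, inv_mul_cancel₀ hh.ne', one_smul]
    ring
  simp only [h2, integral_const_mul] at h1
  exact (mul_left_cancel₀ (by positivity) h1).symm

theorem integrable_mul_scaledKernel_iff (φ : EuclideanSpace ℝ (Fin d) → ℝ) {h : ℝ} (hh : 0 < h) :
    Integrable (fun y => f y * scaledKernel K h (x - y) * φ y)
      ↔ Integrable fun z => f (x - h • z) * (K z * φ (x - h • z)) := by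
  rw [← integrable_comp_sub_smul_iff _ x hh]
  have h2 : ∀ z, f (x - h • z) * scaledKernel K h (x - (x - h • z)) * φ (x - h • z)
      = (h ^ d)⁻¹ * (f (x - h • z) * (K z * φ (x - h • z))) := fun z => by
    rw [sub_sub_cancel, scaledKernel, smul_smul, inv_mul_cancel₀ hh.ne', one_smul]
    ring
  simp only [h2]
  exact integrable_const_mul_iff (by rw [isUnit_iff_ne_zero]; positivity) _

theorem sumDensity_eq_shiftedMoment {h : ℝ} (hh : 0 < h) :
    sumDensity f K h x = shiftedMoment f K x (fun _ => 1) h := by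
  have := integral_mul_scaledKernel (f := f) (K := K) (x := x) (fun _ => 1) hh
  simpa [sumDensity] using this

theorem condDensity_nonneg (hf : IsProbDensity f) (hK : IsRidgeKernel K) {h : ℝ} (hh : 0 < h)
    (y : EuclideanSpace ℝ (Fin d)) : 0 ≤ condDensity f K h x y := by
  have h1 : ∀ y, 0 ≤ f y * scaledKernel K h (x - y) := fun y =>
    mul_nonneg (hf.nonneg y) (mul_nonneg (by positivity) (hK.nonneg _))
  exact div_nonneg (h1 y) (integral_nonneg h1)

theorem aemeasurable_condDensity (hf : IsProbDensity f) (hK : IsRidgeKernel K) {h : ℝ}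
    (hh : 0 < h) : AEMeasurable (fun y => condDensity f K h x y) := by
  have h1 : Integrable fun z => scaledKernel K h z :=
    ((integrable_comp_smul_iff volume K (inv_ne_zero hh.ne')).2 hK.integrable).const_mul _
  exact (hf.integrable.aemeasurable.mul (h1.comp_sub_left x).aemeasurable).div_const _

theorem integral_condLaw (hf : IsProbDensity f) (hK : IsRidgeKernel K) {h : ℝ} (hh : 0 < h)
    (φ : EuclideanSpace ℝ (Fin d) → ℝ) :
    ∫ y, φ y ∂(condLaw f K h x) = shiftedMoment f K x (fun z => φ (x - h • z)) h
      / shiftedMoment f K x (fun _ => 1) h := by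
  rw [condLaw, integral_withDensity_eq_integral_toReal_smul₀
    (aemeasurable_condDensity hf hK hh).ennreal_ofReal (by simp)]
  simp only [ENNReal.toReal_ofReal (condDensity_nonneg hf hK hh _), smul_eq_mul]
  rw [← integral_mul_scaledKernel φ hh, ← sumDensity_eq_shiftedMoment hh, ← integral_div]
  refine integral_congr_ae (Eventually.of_forall fun y => ?_)
  simp only [condDensity]
  ring

theorem integrable_condLaw (hf : IsProbDensity f) (hK : IsRidgeKernel K) {h : ℝ} (hh : 0 < h)
    {φ : EuclideanSpace ℝ (Fin d) → ℝ}
    (hφ : Integrable fun z => f (x - h • z) * (K z * φ (x - h • z))) :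
    Integrable φ (condLaw f K h x) := by
  rw [condLaw, integrable_withDensity_iff_integrable_smul₀'
    (aemeasurable_condDensity hf hK hh).ennreal_ofReal (by simp)]
  simp only [ENNReal.toReal_ofReal (condDensity_nonneg hf hK hh _), smul_eq_mul]
  refine (((integrable_mul_scaledKernel_iff φ hh).2 hφ).div_const (sumDensity f K h x)).congr
    (Eventually.of_forall fun y => ?_)
  simp only [condDensity]
  ring

theorem isProbabilityMeasure_condLaw (hf : IsProbDensity f) (hK : IsRidgeKernel K) {h : ℝ}
    (hh : 0 < h) (h0 : shiftedMoment f K x (fun _ => 1) h ≠ 0) :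
    IsProbabilityMeasure (condLaw f K h x) := by
  have h1 : ∫ y, condDensity f K h x y = 1 := by
    simp only [condDensity]
    rw [integral_div]
    change sumDensity f K h x / _ = 1
    rw [sumDensity_eq_shiftedMoment hh]
    exact div_self h0
  have h2 : Integrable fun y => condDensity f K h x y :=
    Integrable.of_integral_ne_zero (by rw [h1]; exact one_ne_zero)
  refine ⟨?_⟩
  rw [condLaw, withDensity_apply _ MeasurableSet.univ, Measure.restrict_univ,
    ← ofReal_integral_eq_lintegral_ofReal h2
      (Eventually.of_forall fun y => condDensity_nonneg hf hK hh y), h1, ENNReal.ofReal_one]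

theorem memLp_two_condLaw (hf : IsProbDensity f) (hfc : Continuous f) (hK : IsRidgeKernel K)
    (htail : (∃ C : ℝ, ∀ x, f x ≤ C) ∨
      Tendsto (fun z => ‖z‖ ^ (d + 4) * K z) (Bornology.cobounded _) (𝓝 0)) {h : ℝ}
    (hh : 0 < h) : MemLp (fun y => y) 2 (condLaw f K h x) := by
  rw [memLp_two_iff_integrable_sq_norm (by fun_prop)]
  refine integrable_condLaw hf hK hh (integrable_shifted_mul_kernel hf hfc hK htail
    (φ := fun z => ‖x - h • z‖ ^ 2) (C := 2 * (‖x‖ ^ 2 + h ^ 2)) (by fun_prop) (fun z => ?_) hh)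
  rw [abs_of_nonneg (by positivity)]
  have h1 : ‖x - h • z‖ ≤ ‖x‖ + h * ‖z‖ := by
    refine (norm_sub_le _ _).trans_eq ?_
    rw [norm_smul, Real.norm_of_nonneg hh.le]
  calc ‖x - h • z‖ ^ 2 ≤ (‖x‖ + h * ‖z‖) ^ 2 := by gcongr
    _ ≤ 2 * (‖x‖ ^ 2 + (h * ‖z‖) ^ 2) := by nlinarith [sq_nonneg (‖x‖ - h * ‖z‖)]
    _ ≤ 2 * (‖x‖ ^ 2 + h ^ 2) * (1 + ‖z‖ ^ 2) := by
      nlinarith [mul_nonneg (sq_nonneg ‖x‖) (sq_nonneg ‖z‖), sq_nonneg h]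

/-- In the variable `z = (x - y) / h` the conditional covariance is that of the probability density
proportional to `f (x - h z) K z`. -/
theorem condCov_eq (hf : IsProbDensity f) (hfc : Continuous f) (hK : IsRidgeKernel K)
    (htail : (∃ C : ℝ, ∀ x, f x ≤ C) ∨
      Tendsto (fun z => ‖z‖ ^ (d + 4) * K z) (Bornology.cobounded _) (𝓝 0)) {h : ℝ}
    (hh : 0 < h) (h0 : shiftedMoment f K x (fun _ => 1) h ≠ 0) (i j : Fin d) :
    condCov f K h x i j = h ^ 2 *
      (shiftedMoment f K x (fun z => z i * z j) h / shiftedMoment f K x (fun _ => 1) h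
        - shiftedMoment f K x (fun z => z i) h * shiftedMoment f K x (fun z => z j) h
          / shiftedMoment f K x (fun _ => 1) h ^ 2) := by
  have hi1 : Integrable fun z => f (x - h • z) * (K z * 1) :=
    integrable_shifted_mul_kernel hf hfc hK htail continuous_const (C := 1)
      (fun z => by rw [abs_one]; nlinarith) hh
  have hic : ∀ k : Fin d, Integrable fun z => f (x - h • z) * (K z * z k) := fun k =>
    integrable_shifted_mul_kernel hf hfc hK htail (by fun_prop)
      (fun z => abs_coord_le_one_add_sq z k) hh
  have hicc : Integrable fun z => f (x - h • z) * (K z * (z i * z j)) :=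
    integrable_shifted_mul_kernel hf hfc hK htail (by fun_prop)
      (fun z => abs_coord_mul_le z i j) hh
  set M := shiftedMoment f K x (fun _ => 1) h with hM
  have hmean : ∀ k : Fin d, ∫ y, y k ∂(condLaw f K h x)
      = x k - h * (shiftedMoment f K x (fun z => z k) h / M) := fun k => by
    rw [integral_condLaw hf hK hh (fun y => y k), ← hM]
    have h1 : shiftedMoment f K x (fun z => (x - h • z) k) h
        = x k * M - h * shiftedMoment f K x (fun z => z k) h := by
      simp only [hM, shiftedMoment]
      rw [← integral_const_mul, ← integral_const_mul,
        ← integral_sub (hi1.const_mul _) ((hic k).const_mul _)]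
      refine integral_congr_ae (Eventually.of_forall fun z => ?_)
      simp
      ring
    rw [h1]
    field_simp
  simp only [condCov, Matrix.of_apply, ProbabilityTheory.covariance, hmean]
  have hcentred : ∀ p q : ℝ, shiftedMoment f K x (fun z => ((x - h • z) i - (x i - h * p))
        * ((x - h • z) j - (x j - h * q))) h
      = h ^ 2 * (shiftedMoment f K x (fun z => z i * z j) h
        - q * shiftedMoment f K x (fun z => z i) h
        - p * shiftedMoment f K x (fun z => z j) h + p * q * M) := fun p q => by
    have h1 : Integrable fun z => f (x - h • z) * (K z * (z i * z j))
        - q * (f (x - h • z) * (K z * z i)) := hicc.sub ((hic i).const_mul q)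
    have h2 : Integrable fun z => f (x - h • z) * (K z * (z i * z j))
        - q * (f (x - h • z) * (K z * z i)) - p * (f (x - h • z) * (K z * z j)) :=
      h1.sub ((hic j).const_mul p)
    simp only [hM, shiftedMoment]
    rw [← integral_const_mul q, ← integral_const_mul p, ← integral_const_mul (p * q),
      ← integral_sub hicc ((hic i).const_mul q), ← integral_sub h1 ((hic j).const_mul p),
      ← integral_add h2 (hi1.const_mul (p * q)), ← integral_const_mul]
    refine integral_congr_ae (Eventually.of_forall fun z => ?_)
    simp
    ring
  rw [integral_condLaw hf hK hh, hcentred, ← hM]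
  field_simp
  ring

end Conditional

/-! ### Perturbation of spectral projections -/

section Spectral

variable {d : ℕ}

theorem frobNorm_nonneg (M : Matrix (Fin d) (Fin d) ℝ) : 0 ≤ frobNorm M := Real.sqrt_nonneg _

theorem frobNorm_sq (M : Matrix (Fin d) (Fin d) ℝ) : frobNorm M ^ 2 = ∑ i, ∑ j, M i j ^ 2 :=
  Real.sq_sqrt (Finset.sum_nonneg fun _ _ => Finset.sum_nonneg fun _ _ => sq_nonneg _)

theorem trace_mul_le_frobNorm_mul (A B : Matrix (Fin d) (Fin d) ℝ) (hB : B.transpose = B) :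
    (A * B).trace ≤ frobNorm A * frobNorm B := by
  have h := Real.sum_mul_le_sqrt_mul_sqrt (Finset.univ : Finset (Fin d × Fin d))
    (fun p => A p.1 p.2) (fun p => B p.1 p.2)
  simp only [Fintype.sum_prod_type] at h
  refine le_trans (le_of_eq ?_) h
  simp only [Matrix.trace, Matrix.diag, Matrix.mul_apply]
  refine Finset.sum_congr rfl fun i _ => Finset.sum_congr rfl fun j _ => ?_
  rw [← congrFun (congrFun hB i) j, Matrix.transpose_apply]

theorem frobNorm_sq_of_symm {M : Matrix (Fin d) (Fin d) ℝ} (hM : M.transpose = M) :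
    frobNorm M ^ 2 = (M * M).trace := by
  rw [frobNorm_sq]
  simp only [Matrix.trace, Matrix.diag, Matrix.mul_apply]
  refine Finset.sum_congr rfl fun i _ => Finset.sum_congr rfl fun j _ => ?_
  rw [sq]
  congr 1
  rw [← congrFun (congrFun hM i) j, Matrix.transpose_apply]

theorem tendsto_frobNorm_sub {α : Type*} {l : Filter α} {B : α → Matrix (Fin d) (Fin d) ℝ}
    {A : Matrix (Fin d) (Fin d) ℝ} (h : ∀ i j, Tendsto (fun t => B t i j) l (𝓝 (A i j))) :
    Tendsto (fun t => frobNorm (A - B t)) l (𝓝 0) := by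
  have h1 : Tendsto (fun t => ∑ i, ∑ j, (A - B t) i j ^ 2) l
      (𝓝 (∑ i : Fin d, ∑ j : Fin d, (A i j - A i j) ^ 2)) :=
    tendsto_finsetSum _ fun i _ => tendsto_finsetSum _ fun j _ =>
      (tendsto_const_nhds.sub (h i j)).pow 2
  simpa [frobNorm] using h1.sqrt

theorem sortedEigenvalue_antitone (A : Matrix (Fin d) (Fin d) ℝ) :
    Antitone (sortedEigenvalue A) := by
  intro i j hij
  unfold sortedEigenvalue
  split_ifs with hA
  · exact hA.eigenvalues₀_antitone (by simpa using hij)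
  · exact le_rfl

/-- Both traces in a gap estimate are bilinear in the two sets of eigenvalues, with weights the
squared entries of the orthogonal matrix `Vᵀ U`. -/
theorem trace_conj_diagonal_mul (U V : Matrix (Fin d) (Fin d) ℝ) (a c : Fin d → ℝ) :
    (V * Matrix.diagonal a * V.transpose * (U * Matrix.diagonal c * U.transpose)).trace
      = ∑ k, ∑ j, a k * c j * (V.transpose * U) k j ^ 2 := by
  have : (V * Matrix.diagonal a * V.transpose * (U * Matrix.diagonal c * U.transpose)).trace
      = (Matrix.diagonal a * (V.transpose * U) * Matrix.diagonal c
          * (V.transpose * U).transpose).trace := by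
    rw [Matrix.transpose_mul, Matrix.transpose_transpose]
    simp only [Matrix.mul_assoc]
    rw [Matrix.trace_mul_comm V]
    simp only [Matrix.mul_assoc]
  rw [this]
  simp only [Matrix.trace, Matrix.diag]
  refine Finset.sum_congr rfl fun k _ => ?_
  rw [Matrix.mul_apply]
  refine Finset.sum_congr rfl fun j _ => ?_
  rw [Matrix.mul_diagonal, Matrix.diagonal_mul, Matrix.transpose_apply]
  ring

/-- The indicator of the indices of the `d - s` smallest eigenvalues. -/
def perpIndicator (d s : ℕ) (j : Fin d) : ℝ := if s ≤ (j : ℕ) then 1 else 0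

theorem perpColumns_mul_transpose (s : ℕ) (V : Matrix (Fin d) (Fin d) ℝ) :
    perpColumns s V * (perpColumns s V).transpose
      = V * Matrix.diagonal (perpIndicator d s) * V.transpose := by
  ext i k
  have h : (V * Matrix.diagonal (perpIndicator d s) * V.transpose) i k
      = ∑ j : Fin d, if s ≤ (j : ℕ) then V i j * V k j else 0 := by
    simp [Matrix.mul_apply (N := V.transpose), Matrix.mul_diagonal, perpIndicator]
  rw [h, ← Finset.sum_filter]
  exact (Finset.sum_subtype (p := fun j : Fin d => s ≤ (j : ℕ)) _ (by simp)
    fun j => V i j * V k j).symm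

/-- If `U` and `V` have orthonormal columns and those of `V` are eigenvectors of `A`, then among
the projections of the same rank the trace against `A` is smallest at the projection onto the
eigenspaces of the smallest eigenvalues, and it grows quadratically, at a rate given by the
spectral gap. The indices `a` and `b` are those of the eigenvalues on both sides of the gap. -/
theorem gap_mul_projDist_sq_le {s : ℕ} {a b : Fin d} (ha : ∀ k : Fin d, (k : ℕ) < s → k ≤ a)
    (hb : ∀ k : Fin d, s ≤ (k : ℕ) → b ≤ k)
    {A U V : Matrix (Fin d) (Fin d) ℝ} {μ : Fin d → ℝ} (hμ : Antitone μ)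
    (hU : U.transpose * U = 1) (hV : V.transpose * V = 1) (hAV : A * V = V * Matrix.diagonal μ) :
    (μ a - μ b) / 2 * projDist (perpColumns s U) (perpColumns s V) ^ 2
      ≤ (A * (perpColumns s U * (perpColumns s U).transpose
          - perpColumns s V * (perpColumns s V).transpose)).trace := by
  have hU' : U * U.transpose = 1 := mul_eq_one_comm.1 hU
  have hV' : V * V.transpose = 1 := mul_eq_one_comm.1 hV
  have hA : A = V * Matrix.diagonal μ * V.transpose := by
    rw [← hAV, Matrix.mul_assoc, hV', Matrix.mul_one]
  set χ := perpIndicator d s with hχ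
  set G := V.transpose * U with hG
  have hGG : G * G.transpose = 1 := by
    rw [hG, Matrix.transpose_mul, Matrix.transpose_transpose, Matrix.mul_assoc,
      ← Matrix.mul_assoc U, hU', Matrix.one_mul, hV]
  have hGG' : G.transpose * G = 1 := mul_eq_one_comm.1 hGG
  have hrow : ∀ k, ∑ j, G k j ^ 2 = 1 := fun k => by
    have := congrFun (congrFun hGG k) k
    simpa [Matrix.mul_apply, sq] using this
  have hcol : ∀ j, ∑ k, G k j ^ 2 = 1 := fun j => by
    have := congrFun (congrFun hGG' j) j
    simpa [Matrix.mul_apply, sq] using this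
  have hsumk : ∀ a : Fin d → ℝ, ∑ k, ∑ j, a k * G k j ^ 2 = ∑ k, a k := fun a => by
    simp [← Finset.mul_sum, hrow]
  have hsumj : ∀ a : Fin d → ℝ, ∑ k, ∑ j, a j * G k j ^ 2 = ∑ k, a k := fun a => by
    rw [Finset.sum_comm]; simp [← Finset.mul_sum, hcol]
  have hdiag : ∀ (W : Matrix (Fin d) (Fin d) ℝ) (a c : Fin d → ℝ), W.transpose * W = 1 →
      (W * Matrix.diagonal a * W.transpose * (W * Matrix.diagonal c * W.transpose)).trace
        = ∑ k, a k * c k := fun W a c hW => by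
    rw [trace_conj_diagonal_mul, hW]
    simp [Matrix.one_apply]
  have hχχ : ∀ k, χ k * χ k = χ k := fun k => by
    simp [hχ, perpIndicator]
  have hdist : projDist (perpColumns s U) (perpColumns s V) ^ 2
      = 2 * ∑ k, ∑ j, χ j * (1 - χ k) * G k j ^ 2 := by
    have hsymm : ∀ W : Matrix (Fin d) (Fin d) ℝ,
        (W * Matrix.diagonal χ * W.transpose).transpose = W * Matrix.diagonal χ * W.transpose :=
      fun W => by
        simp [Matrix.transpose_mul, Matrix.mul_assoc]
    rw [projDist, perpColumns_mul_transpose, perpColumns_mul_transpose, ← hχ,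
      frobNorm_sq_of_symm (by rw [Matrix.transpose_sub, hsymm, hsymm]), Matrix.sub_mul,
      Matrix.mul_sub, Matrix.mul_sub, Matrix.trace_sub, Matrix.trace_sub, Matrix.trace_sub,
      hdiag U _ _ hU, hdiag V _ _ hV, Matrix.trace_mul_comm (U * _ * _) (V * _ * _),
      trace_conj_diagonal_mul, ← hG]
    simp only [hχχ]
    have e : ∑ k, ∑ j, χ j * (1 - χ k) * G k j ^ 2
        = ∑ k, ∑ j, χ j * G k j ^ 2 - ∑ k, ∑ j, χ k * χ j * G k j ^ 2 := by
      simp only [← Finset.sum_sub_distrib]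
      refine Finset.sum_congr rfl fun k _ => Finset.sum_congr rfl fun j _ => ?_
      ring
    rw [e, hsumj]
    ring
  have htrace : (A * (perpColumns s U * (perpColumns s U).transpose
      - perpColumns s V * (perpColumns s V).transpose)).trace
      = ∑ k, ∑ j, (μ k - μ b) * (χ j - χ k) * G k j ^ 2 := by
    rw [perpColumns_mul_transpose, perpColumns_mul_transpose, ← hχ, hA, Matrix.mul_sub,
      Matrix.trace_sub, hdiag V _ _ hV, trace_conj_diagonal_mul, ← hG, ← hsumk fun k => μ k * χ k]
    -- subtracting a constant from all eigenvalues changes nothing, as the ranks agree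
    have e : ∑ k, ∑ j, (μ k - μ b) * (χ j - χ k) * G k j ^ 2
        = ∑ k, ∑ j, μ k * χ j * G k j ^ 2 - ∑ k, ∑ j, μ k * χ k * G k j ^ 2
          - μ b * (∑ k, ∑ j, χ j * G k j ^ 2 - ∑ k, ∑ j, χ k * G k j ^ 2) := by
      simp only [Finset.mul_sum, ← Finset.sum_sub_distrib]
      refine Finset.sum_congr rfl fun k _ => Finset.sum_congr rfl fun j _ => ?_
      ring
    rw [e, hsumj χ, hsumk χ]
    ring
  rw [hdist, htrace, ← mul_assoc, div_mul_cancel₀ _ (two_ne_zero)]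
  simp only [Finset.mul_sum]
  refine Finset.sum_le_sum fun k _ => Finset.sum_le_sum fun j _ => ?_
  rw [← mul_assoc]
  refine mul_le_mul_of_nonneg_right ?_ (sq_nonneg _)
  have h1 : (k : ℕ) < s → μ a ≤ μ k := fun h => hμ (ha k h)
  have h2 : s ≤ (k : ℕ) → μ k ≤ μ b := fun h => hμ (hb k h)
  simp only [hχ, perpIndicator]
  rcases lt_or_ge (k : ℕ) s with hk | hk <;> rcases lt_or_ge (j : ℕ) s with hj | hj
  · simp [hk.not_ge, hj.not_ge]
  · simpa [hk.not_ge, hj] using h1 hk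
  · simpa [hk, hj.not_ge] using h2 hk
  · simp [hk, hj]

/-- A Davis–Kahan bound: the distance of the spectral projections is at most twice the distance
of the matrices over the spectral gap of one of them. -/
theorem gap_mul_projDist_le {s : ℕ} {a b : Fin d} (hab : a ≤ b)
    (ha : ∀ k : Fin d, (k : ℕ) < s → k ≤ a) (hb : ∀ k : Fin d, s ≤ (k : ℕ) → b ≤ k)
    {A B U V : Matrix (Fin d) (Fin d) ℝ} {μ ν : Fin d → ℝ} (hμ : Antitone μ) (hν : Antitone ν)
    (hU : U.transpose * U = 1) (hV : V.transpose * V = 1)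
    (hBU : B * U = U * Matrix.diagonal ν) (hAV : A * V = V * Matrix.diagonal μ) :
    (μ a - μ b) * projDist (perpColumns s U) (perpColumns s V)
      ≤ 2 * frobNorm (A - B) := by
  have h1 := gap_mul_projDist_sq_le ha hb hμ hU hV hAV
  have h2 := gap_mul_projDist_sq_le ha hb hν hV hU hBU
  have hgap : 0 ≤ ν a - ν b :=
    sub_nonneg.2 (hν hab)
  have h3 : 0 ≤ (B * (perpColumns s V * (perpColumns s V).transpose
      - perpColumns s U * (perpColumns s U).transpose)).trace :=
    le_trans (by positivity) h2
  have h4 := trace_mul_le_frobNorm_mul (A - B) (perpColumns s U * (perpColumns s U).transpose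
      - perpColumns s V * (perpColumns s V).transpose)
      (by simp [Matrix.transpose_sub, Matrix.transpose_mul])
  rw [← neg_sub (perpColumns s U * _), Matrix.mul_neg, Matrix.trace_neg] at h3
  rw [Matrix.sub_mul, Matrix.trace_sub] at h4
  change _ ≤ frobNorm (A - B) * projDist (perpColumns s U) (perpColumns s V) at h4
  have h5 : 0 ≤ projDist (perpColumns s U) (perpColumns s V) := frobNorm_nonneg _
  rcases h5.eq_or_lt with h0 | h0
  · rw [← h0, mul_zero]
    exact mul_nonneg zero_le_two (frobNorm_nonneg _)
  · refine le_of_mul_le_mul_right ?_ h0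
    nlinarith

end Spectral

/-! ### Convergence of the rescaled covariance and of its spectral projections -/

section Limit

variable {d : ℕ} {f K : EuclideanSpace ℝ (Fin d) → ℝ} {x : EuclideanSpace ℝ (Fin d)}

theorem tendsto_pow_nhdsGT_zero {n : ℕ} (hn : n ≠ 0) :
    Tendsto (fun h : ℝ => h ^ n) (𝓝[>] 0) (𝓝 0) := by
  have := ((continuous_pow (M := ℝ) n).tendsto 0).mono_left (nhdsWithin_le_nhds (s := Set.Ioi 0))
  rwa [zero_pow hn] at this

theorem tendsto_shiftedMoment_one (hf : IsProbDensity f) (hf2 : ContDiff ℝ 2 f)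
    (hK : IsRidgeKernel K)
    (htail : (∃ C : ℝ, ∀ x, f x ≤ C) ∨
      Tendsto (fun z => ‖z‖ ^ (d + 4) * K z) (Bornology.cobounded _) (𝓝 0)) :
    Tendsto (fun h => (h ^ 2)⁻¹ * (shiftedMoment f K x (fun _ => 1) h - f x)) (𝓝[>] 0)
      (𝓝 (1 / 2 * ∑ k, fderiv ℝ (fderiv ℝ f) x (EuclideanSpace.single k 1)
        (EuclideanSpace.single k 1))) := by
  have h := tendsto_moment_expansion (x := x) hf hf2 hK htail
    (continuous_const (y := (1 : ℝ))) (C := 1) (fun z => by rw [abs_one]; nlinarith)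
  have hL : ∫ z, K z * fderiv ℝ f x z = 0 := hK.integral_mul_eq_zero_of_odd fun z => map_neg _ z
  simp only [mul_one, hK.integral_eq_one, hL, hK.integral_mul_quadratic, mul_zero, sub_zero] at h
  refine ((h.add_const (1 / 2 * ∑ k, fderiv ℝ (fderiv ℝ f) x (EuclideanSpace.single k 1)
        (EuclideanSpace.single k 1))).congr' ?_).trans (by rw [zero_add])
  filter_upwards [self_mem_nhdsWithin] with h hh
  have : h ≠ 0 := (Set.mem_Ioi.1 hh).ne'
  simp only [shiftedMoment, mul_one]
  field_simp
  ring

theorem tendsto_shiftedMoment_coord (hf : IsProbDensity f) (hf2 : ContDiff ℝ 2 f)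
    (hK : IsRidgeKernel K)
    (htail : (∃ C : ℝ, ∀ x, f x ≤ C) ∨
      Tendsto (fun z => ‖z‖ ^ (d + 4) * K z) (Bornology.cobounded _) (𝓝 0)) (i : Fin d) :
    Tendsto (fun h => h⁻¹ * shiftedMoment f K x (fun z => z i) h) (𝓝[>] 0)
      (𝓝 (-fderiv ℝ f x (EuclideanSpace.single i 1))) := by
  have h := tendsto_moment_expansion (x := x) hf hf2 hK htail
    (φ := fun z => z i) (by fun_prop) (fun z => abs_coord_le_one_add_sq z i)
  have h1 : ∫ z, K z * z i = 0 := hK.integral_mul_eq_zero_of_odd fun z => by simp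
  have h3 : ∫ z, K z * (fderiv ℝ (fderiv ℝ f) x z z * z i) = 0 :=
    hK.integral_mul_eq_zero_of_odd fun z => by simp
  simp only [h1, h3, hK.integral_mul_linear_coord, mul_zero, zero_sub, add_zero] at h
  have h' := (tendsto_pow_nhdsGT_zero one_ne_zero).mul h
  rw [zero_mul] at h'
  refine ((h'.add_const (-fderiv ℝ f x (EuclideanSpace.single i 1))).congr' ?_).trans
    (by rw [zero_add])
  filter_upwards [self_mem_nhdsWithin] with h hh
  have : h ≠ 0 := (Set.mem_Ioi.1 hh).ne'
  simp only [shiftedMoment]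
  field_simp
  ring

theorem tendsto_shiftedMoment_coord_mul (hf : IsProbDensity f) (hf2 : ContDiff ℝ 2 f)
    (hK : IsRidgeKernel K)
    (htail : (∃ C : ℝ, ∀ x, f x ≤ C) ∨
      Tendsto (fun z => ‖z‖ ^ (d + 4) * K z) (Bornology.cobounded _) (𝓝 0)) (i j : Fin d) :
    Tendsto (fun h => (h ^ 2)⁻¹ * (shiftedMoment f K x (fun z => z i * z j) h
      - (if i = j then 1 else 0) * f x)) (𝓝[>] 0)
      (𝓝 ((if i = j then 1 else 0) * (1 / 2 * ∑ k, fderiv ℝ (fderiv ℝ f) x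
        (EuclideanSpace.single k 1) (EuclideanSpace.single k 1))
        + fderiv ℝ (fderiv ℝ f) x (EuclideanSpace.single i 1) (EuclideanSpace.single j 1))) := by
  have h := tendsto_moment_expansion (x := x) hf hf2 hK htail
    (φ := fun z => z i * z j) (by fun_prop) (fun z => abs_coord_mul_le z i j)
  have h1 : ∫ z, K z * (fderiv ℝ f x z * (z i * z j)) = 0 :=
    hK.integral_mul_eq_zero_of_odd fun z => by simp
  have hsymm : IsSymmSndFDerivAt ℝ f x := hf2.contDiffAt.isSymmSndFDerivAt (by simp)
  simp only [h1, hK.second_moment, hK.integral_mul_quadratic_coord_coord, mul_zero, sub_zero,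
    hsymm (EuclideanSpace.single j 1) (EuclideanSpace.single i 1)] at h
  refine ((h.add_const ((if i = j then 1 else 0) * (1 / 2 * ∑ k, fderiv ℝ (fderiv ℝ f) x
        (EuclideanSpace.single k 1) (EuclideanSpace.single k 1))
        + fderiv ℝ (fderiv ℝ f) x (EuclideanSpace.single i 1)
          (EuclideanSpace.single j 1))).congr' ?_).trans (by rw [zero_add])
  filter_upwards [self_mem_nhdsWithin] with h hh
  have : h ≠ 0 := (Set.mem_Ioi.1 hh).ne'
  simp only [shiftedMoment]
  generalize (if i = j then (1 : ℝ) else 0) = δ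
  field_simp
  ring

theorem tendsto_shiftedMoment_one_nhds (hf : IsProbDensity f) (hf2 : ContDiff ℝ 2 f)
    (hK : IsRidgeKernel K)
    (htail : (∃ C : ℝ, ∀ x, f x ≤ C) ∨
      Tendsto (fun z => ‖z‖ ^ (d + 4) * K z) (Bornology.cobounded _) (𝓝 0)) :
    Tendsto (shiftedMoment f K x fun _ => 1) (𝓝[>] 0) (𝓝 (f x)) := by
  have h := ((tendsto_pow_nhdsGT_zero two_ne_zero).mul
    (tendsto_shiftedMoment_one (x := x) hf hf2 hK htail)).add_const (f x)
  rw [zero_mul, zero_add] at h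
  refine h.congr' ?_
  filter_upwards [self_mem_nhdsWithin] with h hh
  have : h ≠ 0 := (Set.mem_Ioi.1 hh).ne'
  field_simp
  ring

/-- The correction of the conditional covariance to its leading term `h ^ 2 • 1`, on the scale
`h ^ 4`. It has the same eigenvectors as the conditional covariance. -/
noncomputable def rescaledCov (f K : EuclideanSpace ℝ (Fin d) → ℝ)
    (x : EuclideanSpace ℝ (Fin d)) (h : ℝ) : Matrix (Fin d) (Fin d) ℝ :=
  (h ^ 2)⁻¹ • ((h ^ 2)⁻¹ • condCov f K h x - 1)

/-- In the limit the traces of `D²f(x)`, which enter through the fourth moments and through the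
normalization, cancel, and the square of the first moments supplies the gradient term of the
Hessian of `log f`. -/
theorem tendsto_rescaledCov (hf : IsProbDensity f) (hf2 : ContDiff ℝ 2 f)
    (hK : IsRidgeKernel K)
    (htail : (∃ C : ℝ, ∀ x, f x ≤ C) ∨
      Tendsto (fun z => ‖z‖ ^ (d + 4) * K z) (Bornology.cobounded _) (𝓝 0))
    (hx : 0 < f x) (i j : Fin d) :
    Tendsto (fun h => rescaledCov f K x h i j) (𝓝[>] 0)
      (𝓝 (hessianMatrix (fun y => Real.log (f y)) x i j)) := by
  have hM := tendsto_shiftedMoment_one_nhds (x := x) hf hf2 hK htail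
  have hM1 := tendsto_shiftedMoment_one (x := x) hf hf2 hK htail
  have hi := tendsto_shiftedMoment_coord (x := x) hf hf2 hK htail i
  have hj := tendsto_shiftedMoment_coord (x := x) hf hf2 hK htail j
  have hij := tendsto_shiftedMoment_coord_mul (x := x) hf hf2 hK htail i j
  -- dividing by `h ^ 2`, the covariance of `z` minus `δᵢⱼ` is `(Mᵢⱼ - δᵢⱼ M) / (h² M)` minus
  -- `(Mᵢ / h) (Mⱼ / h) / M²`, and each factor has a limit
  have hlim := ((hij.sub (hM1.const_mul (if i = j then (1 : ℝ) else 0))).div hM hx.ne').sub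
    ((hi.mul hj).div (hM.pow 2) (pow_ne_zero 2 hx.ne'))
  rw [neg_mul_neg, add_sub_cancel_left, ← hessianMatrix_log hf2 hx] at hlim
  refine hlim.congr' ?_
  filter_upwards [self_mem_nhdsWithin, hM.eventually_ne hx.ne'] with h hh h0
  have hne : h ≠ 0 := (Set.mem_Ioi.1 hh).ne'
  simp only [Pi.div_apply, rescaledCov, Matrix.smul_apply, Matrix.sub_apply, Matrix.one_apply,
    smul_eq_mul, condCov_eq hf hf2.continuous hK htail hh h0]
  generalize (if i = j then (1 : ℝ) else 0) = δ
  field_simp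
  ring

end Limit

theorem theorem1 {d s : ℕ} (hs : 1 ≤ s) (hsd : s < d)
    (f K : EuclideanSpace ℝ (Fin d) → ℝ)
    (hf : IsProbDensity f) (hf2 : ContDiff ℝ 2 f)
    (hgap : ∀ x, 0 < f x →
      0 < sortedEigenvalue (hessianMatrix (fun y => Real.log (f y)) x) ⟨s - 1, by omega⟩
        - sortedEigenvalue (hessianMatrix (fun y => Real.log (f y)) x) ⟨s, hsd⟩)
    (hK : IsRidgeKernel K)
    (htail : (∃ C : ℝ, ∀ x, f x ≤ C) ∨
      Tendsto (fun z => ‖z‖ ^ (d + 4) * K z) (Bornology.cobounded _) (𝓝 0))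
    (x : EuclideanSpace ℝ (Fin d)) (hx : 0 < f x) :
    (∀ᶠ h in 𝓝[>] (0 : ℝ), IsProbabilityMeasure (condLaw f K h x) ∧
      MemLp (fun y => y) 2 (condLaw f K h x)) ∧
    ∀ (V : ℝ → Matrix (Fin d) (Fin d) ℝ) (W : Matrix (Fin d) (Fin d) ℝ),
      (∀ h, 0 < h → IsEigenvectorMatrix (condCov f K h x) (V h)) →
      IsEigenvectorMatrix (hessianMatrix (fun y => Real.log (f y)) x) W →
      Tendsto (fun h => projDist (perpColumns s (V h)) (perpColumns s W)) (𝓝[>] 0) (𝓝 0) := by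
  have hM := tendsto_shiftedMoment_one_nhds (x := x) hf hf2 hK htail
  refine ⟨?_, fun V W hV hW => ?_⟩
  · filter_upwards [self_mem_nhdsWithin, hM.eventually_ne hx.ne'] with h hh h0
    exact ⟨isProbabilityMeasure_condLaw hf hK hh h0,
      memLp_two_condLaw hf hf2.continuous hK htail hh⟩
  set A := hessianMatrix (fun y => Real.log (f y)) x
  set γ := sortedEigenvalue A ⟨s - 1, by omega⟩ - sortedEigenvalue A ⟨s, hsd⟩
  have hγ : 0 < γ := hgap x hx
  have hlim : Tendsto (fun h => 2 * frobNorm (A - rescaledCov f K x h) / γ) (𝓝[>] 0) (𝓝 0) := by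
    have := ((tendsto_frobNorm_sub (tendsto_rescaledCov hf hf2 hK htail hx)).const_mul
      2).div_const γ
    simpa using this
  refine squeeze_zero' (Eventually.of_forall fun h => frobNorm_nonneg _) ?_ hlim
  filter_upwards [self_mem_nhdsWithin] with h hh
  rw [le_div_iff₀ hγ, mul_comm]
  have hh0 : 0 < h := hh
  -- the affine map taking the covariance to its correction is increasing, so it preserves the
  -- order of the eigenvalues
  refine gap_mul_projDist_le (Fin.le_def.2 (by simp))
    (fun k hk => Fin.le_def.2 (Nat.le_sub_one_of_lt hk)) (fun k hk => Fin.le_def.2 hk)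
    (sortedEigenvalue_antitone A)
    (ν := fun k => (h ^ 2)⁻¹ * ((h ^ 2)⁻¹ * sortedEigenvalue (condCov f K h x) k - 1))
    (fun k l hkl => ?_) (hV h hh).1 hW.1 ?_ hW.2
  · have := sortedEigenvalue_antitone (condCov f K h x) hkl
    simp only
    gcongr
  · rw [rescaledCov, Matrix.smul_mul, Matrix.sub_mul, Matrix.smul_mul, (hV h hh).2]
    ext k l
    simp only [Matrix.smul_apply, Matrix.sub_apply, Matrix.mul_diagonal, Matrix.one_mul,
      smul_eq_mul]
    ring
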